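/- Let $K\subset\mathbb R^n$ be a star-shaped body, i.e. a compact set with nonempty interior such that $tx\in K$ for all $x\in K$ and $t\in[0,1]$. Suppose that the barycenter $\frac{1}{\mathrm{vol}(K)}\int_K x\,dx$ of $K$ is the origin, and let $$K^*=\{y\in\mathbb R^n:\ \langle x,y\rangle\le 1 \text{ for all } x\in K\}$$ be the polar of $K$. Then $$\mathrm{vol}(K)\,\mathrm{vol}(K^*)\le \mathrm{vol}(B_2^n)^2,$$ where $\mathrm{vol}$ is Lebesgue measure on $\mathbb R^n$ and $B_2^n$ is the Euclidean unit ball. -/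

import Mathlib

open MeasureTheory

/-- A star-shaped body in `ℝⁿ`: a compact set with nonempty interior which is star-shaped
about the origin, that is, `t • x ∈ K` for all `x ∈ K` and `t ∈ [0, 1]`. -/
structure IsStarShapedBody {n : ℕ} (K : Set (EuclideanSpace ℝ (Fin n))) : Prop where
  isCompact : IsCompact K
  interior_nonempty : (interior K).Nonempty
  smul_mem : ∀ x ∈ K, ∀ t ∈ Set.Icc (0 : ℝ) 1, t • x ∈ K

/-- The (one-sided) polar of `K`: all `y` with `⟨x, y⟩ ≤ 1` for every `x ∈ K`. -/
def polarBody {n : ℕ} (K : Set (EuclideanSpace ℝ (Fin n))) : Set (EuclideanSpace ℝ (Fin n)) :=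
  {y | ∀ x ∈ K, inner ℝ x y ≤ 1}

/-- The barycenter `vol(K)⁻¹ ∫_K x dx` of `K` with respect to Lebesgue measure. -/
noncomputable def barycenter {n : ℕ} (K : Set (EuclideanSpace ℝ (Fin n))) :
    EuclideanSpace ℝ (Fin n) :=
  (volume.real K)⁻¹ • ∫ x in K, x

open scoped ENNReal Pointwise

/-! The volume inequality is deduced from a functional one: if `f` has its barycenter at the origin
and `f x * g y ≤ exp (-⟨x, y⟩)`, then `∫ f * ∫ g ≤ (2π)^n`. For star-shaped `K` take `f = exp
(-‖x‖_K² / 2)`, and build `g` likewise from the polar. Both are mixtures of indicators of dilates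
(`gaugeGaussian`), so their integrals are volumes times a constant `c` depending only on `n`. The
unit ball gives the Gaussian, for which `(c * vol B)² = (2π)^n`, and `c²` cancels.

The functional inequality is proved by induction on dimension. On a half-line, `φ s * ψ t ≤ exp (-s
t)` gives `∫ φ * ∫ ψ ≤ π / 2`, by Prékopa–Leindler after `s = exp a`. For `ℝ × E`, cut `g` into two
halves of equal mass by a hyperplane `t = c`; one translation and one shear centre the
`E`-components of both halves. Integrating out the first coordinate on each half leaves a dual pair
on `E` (`FunctionalSantalo.half_space`). The dual change of variables shears `f` and multiplies it
by `exp L` with `L` linear; as `f` is centred, `exp L ≥ 1 + L` shows that its integral does not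
decrease. -/

/-! ### One-dimensional Brunn–Minkowski and Prékopa–Leindler -/

/-- The one-dimensional Brunn–Minkowski inequality for compact sets. -/
theorem IsCompact.volume_add_volume_le_volume_add {A B : Set ℝ} (hA : IsCompact A)
    (hB : IsCompact B) (hA' : A.Nonempty) (hB' : B.Nonempty) :
    volume A + volume B ≤ volume (A + B) := by
  obtain ⟨a, haA, ha⟩ := hA.exists_isGreatest hA'
  obtain ⟨b, hbB, hb⟩ := hB.exists_isLeast hB'
  -- With `a = max A` and `b = min B`, these two translates meet at most in the point `a + b`.
  have h1 : ((a + ·) '' B) ∪ ((· + b) '' A) ⊆ A + B := by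
    rintro x (⟨y, hy, rfl⟩ | ⟨y, hy, rfl⟩)
    · exact Set.add_mem_add haA hy
    · exact Set.add_mem_add hy hbB
  have h2 : ((a + ·) '' B) ∩ ((· + b) '' A) ⊆ {a + b} := by
    rintro x ⟨⟨y, hy, rfl⟩, z, hz, hzy⟩
    have h3 := ha hz
    have h4 := hb hy
    simp only [Set.mem_singleton_iff] at hzy ⊢
    linarith
  have h3 : AEDisjoint volume ((a + ·) '' B) ((· + b) '' A) :=
    measure_mono_null h2 (by simp)
  have h4 : MeasurableSet ((· + b) '' A) :=
    (hA.image (continuous_add_const b)).isClosed.measurableSet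
  calc volume A + volume B = volume (((a + ·) '' B) ∪ ((· + b) '' A)) := by
        rw [measure_union₀ h4.nullMeasurableSet h3]
        simp [add_comm]
    _ ≤ _ := measure_mono h1

/-- The one-dimensional Brunn–Minkowski inequality, in terms of midpoints. -/
theorem volume_add_volume_le_two_mul_of_midpoint {A B S : Set ℝ} (hA : MeasurableSet A)
    (hB : MeasurableSet B) (hA' : A.Nonempty) (hB' : B.Nonempty)
    (hS : ∀ a ∈ A, ∀ b ∈ B, (a + b) / 2 ∈ S) :
    volume A + volume B ≤ 2 * volume S := by
  have hcomp : ∀ A' ⊆ A, IsCompact A' → ∀ B' ⊆ B, IsCompact B' →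
      A'.Nonempty → B'.Nonempty → volume A' + volume B' ≤ 2 * volume S := by
    intro A' hAA hA'c B' hBB hB'c hA'n hB'n
    refine (hA'c.volume_add_volume_le_volume_add hB'c hA'n hB'n).trans ?_
    have : A' + B' ⊆ (2 : ℝ) • S := by
      rintro _ ⟨a, ha, b, hb, rfl⟩
      refine ⟨_, hS a (hAA ha) b (hBB hb), ?_⟩
      simp only [smul_eq_mul]; ring
    refine (measure_mono this).trans ?_
    rw [Measure.addHaar_smul]
    simp
  obtain ⟨a, ha⟩ := hA'
  obtain ⟨b, hb⟩ := hB'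
  have h1 : ∀ B' ⊆ B, IsCompact B' → B'.Nonempty → volume A + volume B' ≤ 2 * volume S := by
    intro B' hBB hB'c hB'n
    have : volume A ≤ 2 * volume S - volume B' := by
      -- Inner regularity; the point `a` is inserted into each compact subset to keep it nonempty.
      rw [hA.measure_eq_iSup_isCompact]
      refine iSup₂_le fun K hKA => iSup_le fun hK => ?_
      refine ENNReal.le_sub_of_add_le_right hB'c.measure_ne_top (le_trans ?_
        (hcomp (insert a K) (Set.insert_subset ha hKA) (hK.insert a) B' hBB hB'c
          (Set.insert_nonempty _ _) hB'n))
      gcongr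
      exact Set.subset_insert _ _
    have h2 : volume B' ≤ 2 * volume S :=
      le_add_self.trans (hcomp {a} (by simpa using ha) isCompact_singleton B' hBB hB'c
        (Set.singleton_nonempty a) hB'n)
    exact (add_le_add_left this _).trans_eq (tsub_add_cancel_of_le h2)
  have h3 : volume A ≤ 2 * volume S :=
    le_self_add.trans (h1 {b} (by simpa using hb) isCompact_singleton (Set.singleton_nonempty b))
  rcases eq_or_ne (volume A) ∞ with hAt | hAt
  · rw [hAt, top_le_iff] at h3
    simp [h3]
  have : volume B ≤ 2 * volume S - volume A := by
    rw [hB.measure_eq_iSup_isCompact]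
    refine iSup₂_le fun K hKB => iSup_le fun hK => ?_
    refine ENNReal.le_sub_of_add_le_left hAt (le_trans ?_
      (h1 (insert b K) (Set.insert_subset hb hKB) (hK.insert b) (Set.insert_nonempty _ _)))
    gcongr
    exact Set.subset_insert _ _
  exact (add_le_add_right this _).trans_eq (add_tsub_cancel_of_le h3)

/-- A normalized form of the one-dimensional Prékopa–Leindler inequality. -/
theorem lintegral_add_lintegral_le_of_midpoint {u v h : ℝ → ℝ} (hu : Measurable u)
    (hv : Measurable v) (hh : Measurable h) (hu0 : 0 ≤ u) (hv0 : 0 ≤ v) (hh0 : 0 ≤ h)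
    (hu1 : u ≤ 1) (hv1 : v ≤ 1) (hus : ∀ c < 1, ∃ a, c < u a) (hvs : ∀ c < 1, ∃ b, c < v b)
    (H : ∀ c ∈ Set.Ioo (0 : ℝ) 1, ∀ a b, c < u a → c < v b → c < h ((a + b) / 2)) :
    (∫⁻ a, ENNReal.ofReal (u a)) + ∫⁻ b, ENNReal.ofReal (v b) ≤
      2 * ∫⁻ m, ENNReal.ofReal (h m) := by
  have key : ∀ w : ℝ → ℝ, Measurable w → 0 ≤ w → w ≤ 1 → ∫⁻ a, ENNReal.ofReal (w a) =
      ∫⁻ t in Set.Ioo (0 : ℝ) 1, volume {a | t < w a} := by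
    intro w hw hw0 hw1
    rw [lintegral_eq_lintegral_meas_lt _ (Filter.Eventually.of_forall hw0) hw.aemeasurable,
      ← Set.Ioo_union_Ici_eq_Ioi (zero_lt_one' ℝ),
      lintegral_union measurableSet_Ici (by
        rw [Set.disjoint_left]; intro x hx hx'; exact absurd hx.2 (not_lt.2 hx'))]
    rw [setLIntegral_congr_fun (g := fun _ => 0) measurableSet_Ici]
    · simp
    · intro t ht
      have : {a | t < w a} = ∅ := by
        ext a; simpa using (hw1 a).trans ht
      simp [this]
  rw [key u hu hu0 hu1, key v hv hv0 hv1,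
    lintegral_eq_lintegral_meas_lt _ (Filter.Eventually.of_forall hh0) hh.aemeasurable,
    ← lintegral_add_right _ (by
      apply Antitone.measurable
      intro s t hst
      exact measure_mono fun a ha => lt_of_le_of_lt hst ha),
    ← lintegral_const_mul _ (by
      apply Antitone.measurable
      intro s t hst
      exact measure_mono fun a ha => lt_of_le_of_lt hst ha)]
  -- Levels in `(0, 1)` suffice for `u` and `v`, and there both superlevel sets are nonempty, as
  -- Brunn–Minkowski needs.
  refine (setLIntegral_mono' measurableSet_Ioo fun t ht => ?_).trans
    (lintegral_mono_set Set.Ioo_subset_Ioi_self)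
  exact volume_add_volume_le_two_mul_of_midpoint (measurableSet_lt measurable_const hu)
    (measurableSet_lt measurable_const hv) (hus t ht.2) (hvs t ht.2)
    fun a ha b hb => H t ht a b ha hb

theorem ENNReal.four_mul_mul_le_add_sq (a b : ℝ≥0∞) : 4 * (a * b) ≤ (a + b) ^ 2 := by
  rcases eq_or_ne a ∞ with rfl | ha
  · simp
  rcases eq_or_ne b ∞ with rfl | hb
  · simp
  lift a to NNReal using ha
  lift b to NNReal using hb
  norm_cast
  rw [← mul_assoc]
  exact four_mul_le_sq_add a b

/-- The one-dimensional Prékopa–Leindler inequality for a bounded majorant. -/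
theorem lintegral_mul_lintegral_le_sq_of_midpoint {u v : ℝ → ℝ≥0∞} {h : ℝ → ℝ}
    (hu : Measurable u) (hv : Measurable v) (hh : Measurable h) (hh0 : 0 ≤ h) {M : ℝ}
    (hM : ∀ m, h m ≤ M) (H : ∀ a b, u a * v b ≤ ENNReal.ofReal (h ((a + b) / 2)) ^ 2) :
    (∫⁻ a, u a) * ∫⁻ b, v b ≤ (∫⁻ m, ENNReal.ofReal (h m)) ^ 2 := by
  by_cases hu0 : ∀ a, u a = 0
  · simp [hu0]
  by_cases hv0 : ∀ a, v a = 0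
  · simp [hv0]
  push Not at hu0 hv0
  obtain ⟨a₀, ha₀⟩ := hu0
  obtain ⟨b₀, hb₀⟩ := hv0
  have HM : ∀ a b, u a * v b ≤ ENNReal.ofReal M ^ 2 := fun a b =>
    (H a b).trans (by gcongr; exact hM _)
  have bdd : ∀ (u v : ℝ → ℝ≥0∞), (∀ a b, u a * v b ≤ ENNReal.ofReal M ^ 2) → (∃ b, v b ≠ 0) →
      ⨆ a, u a ≠ ∞ := by
    rintro u v HM ⟨b, hb⟩
    have : ⨆ a, u a ≤ ENNReal.ofReal M ^ 2 / v b :=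
      iSup_le fun a => (ENNReal.le_div_iff_mul_le (.inl hb) (.inr (by simp))).2 (HM a b)
    exact ne_top_of_le_ne_top (ENNReal.div_ne_top (by simp) hb) this
  have hAt := bdd u v HM ⟨b₀, hb₀⟩
  have hBt := bdd v u (fun a b => by rw [mul_comm]; exact HM b a) ⟨a₀, ha₀⟩
  set A := ⨆ a, u a with hA
  set B := ⨆ b, v b with hB
  have hA0 : A ≠ 0 := fun h => ha₀ (le_antisymm (h ▸ le_iSup u a₀) zero_le)
  have hB0 : B ≠ 0 := fun h => hb₀ (le_antisymm (h ▸ le_iSup v b₀) zero_le)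
  have huA : ∀ a, u a ≤ A := fun a => le_iSup u a
  have hvB : ∀ a, v a ≤ B := fun a => le_iSup v a
  have hA1 : 0 < A.toReal := ENNReal.toReal_pos hA0 hAt
  have hB1 : 0 < B.toReal := ENNReal.toReal_pos hB0 hBt
  -- Dividing `u`, `v` by their suprema and `h` by the geometric mean `q` of these preserves the
  -- hypothesis and normalizes both suprema to `1`.
  set q := √(A.toReal * B.toReal) with hq
  have hq0 : 0 < q := by positivity
  have hq2 : q ^ 2 = A.toReal * B.toReal := Real.sq_sqrt (by positivity)
  have norm_le : ∀ (w : ℝ → ℝ≥0∞) (A : ℝ≥0∞), A ≠ 0 → A ≠ ∞ → (∀ a, w a ≤ A) →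
      (fun a => (w a).toReal / A.toReal) ≤ 1 := by
    intro w A h0 ht hw a
    have : 0 < A.toReal := ENNReal.toReal_pos h0 ht
    simp only [Pi.one_apply]
    rw [div_le_one this]
    exact ENNReal.toReal_mono ht (hw a)
  have norm_sup : ∀ (w : ℝ → ℝ≥0∞), ⨆ a, w a ≠ 0 → ⨆ a, w a ≠ ∞ →
      ∀ c < 1, ∃ a, c < (w a).toReal / (⨆ a, w a).toReal := by
    intro w h0 ht c hc
    have hp : 0 < (⨆ a, w a).toReal := ENNReal.toReal_pos h0 ht
    have hc0 : 0 ≤ max c 0 * (⨆ a, w a).toReal := by positivity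
    have h1 : ENNReal.ofReal (max c 0 * (⨆ a, w a).toReal) < ⨆ a, w a := by
      rw [ENNReal.ofReal_lt_iff_lt_toReal hc0 ht]
      exact mul_lt_of_lt_one_left hp (max_lt hc one_pos)
    obtain ⟨a, ha⟩ := lt_iSup_iff.1 h1
    refine ⟨a, (le_max_left c 0).trans_lt ?_⟩
    rw [lt_div_iff₀ hp]
    exact (ENNReal.ofReal_lt_iff_lt_toReal hc0 (ne_top_of_le_ne_top ht (le_iSup w a))).1 ha
  have norm_int : ∀ (w : ℝ → ℝ≥0∞) (A : ℝ≥0∞), A ≠ 0 → A ≠ ∞ → (∀ a, w a ≤ A) →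
      ∫⁻ a, w a = A * ∫⁻ a, ENNReal.ofReal ((w a).toReal / A.toReal) := by
    intro w A h0 ht hw
    rw [← lintegral_const_mul' _ _ ht]
    congr with a
    rw [ENNReal.ofReal_div_of_pos (ENNReal.toReal_pos h0 ht), ENNReal.ofReal_toReal ht,
      ENNReal.ofReal_toReal (ne_top_of_le_ne_top ht (hw a)), ENNReal.mul_div_cancel h0 ht]
  have main := lintegral_add_lintegral_le_of_midpoint
    (u := fun a => (u a).toReal / A.toReal) (v := fun b => (v b).toReal / B.toReal)
    (h := fun m => h m / q) (by fun_prop) (by fun_prop) (by fun_prop)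
    (fun a => by simp only [Pi.zero_apply]; positivity)
    (fun a => by simp only [Pi.zero_apply]; positivity)
    (fun a => div_nonneg (hh0 a) hq0.le)
    (norm_le u A hA0 hAt huA) (norm_le v B hB0 hBt hvB) (norm_sup u hA0 hAt)
    (norm_sup v hB0 hBt) (by
      intro c hc a b ha hb
      have h1 := H a b
      rw [lt_div_iff₀ hA1] at ha
      rw [lt_div_iff₀ hB1] at hb
      rw [lt_div_iff₀ hq0]
      have h2 : (u a).toReal * (v b).toReal ≤ h ((a + b) / 2) ^ 2 := by
        have := ENNReal.toReal_mono (by simp) h1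
        rwa [ENNReal.toReal_mul, ENNReal.toReal_pow, ENNReal.toReal_ofReal (hh0 _)] at this
      refine lt_of_pow_lt_pow_left₀ 2 (hh0 _) (lt_of_lt_of_le ?_ h2)
      calc (c * q) ^ 2 = (c * A.toReal) * (c * B.toReal) := by rw [mul_pow, hq2]; ring
        _ < _ := mul_lt_mul'' ha hb (by have := hc.1; positivity) (by have := hc.1; positivity))
  have hhq : ∫⁻ m, ENNReal.ofReal (h m) = ENNReal.ofReal q * ∫⁻ m, ENNReal.ofReal (h m / q) := by
    rw [← lintegral_const_mul' _ _ (by simp)]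
    congr with m
    rw [← ENNReal.ofReal_mul hq0.le, mul_div_cancel₀ _ hq0.ne']
  rw [norm_int u A hA0 hAt huA, norm_int v B hB0 hBt hvB, hhq, mul_pow, ← ENNReal.ofReal_pow hq0.le,
    hq2, ENNReal.ofReal_mul hA1.le, ENNReal.ofReal_toReal hAt, ENNReal.ofReal_toReal hBt,
    mul_mul_mul_comm]
  gcongr
  -- The arithmetic–geometric mean inequality turns the additive bound `main` into the product
  -- bound.
  refine (ENNReal.mul_le_mul_iff_right (a := 4) (by simp) (by simp)).1 ?_
  refine (ENNReal.four_mul_mul_le_add_sq _ _).trans ((pow_le_pow_left₀ zero_le main 2).trans ?_)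
  rw [mul_pow]; norm_num

/-! ### The Santaló inequality on half-lines -/

/-- The substitution `s = exp a` turns geometric means on the half-line into midpoints. -/
theorem setLIntegral_Ioi_eq_lintegral_comp_exp (φ : ℝ → ℝ≥0∞) :
    ∫⁻ s in Set.Ioi 0, φ s = ∫⁻ a, ENNReal.ofReal (Real.exp a) * φ (Real.exp a) := by
  have := lintegral_image_eq_lintegral_abs_deriv_mul (s := Set.univ) (f := Real.exp)
    MeasurableSet.univ (fun x _ => (Real.hasDerivAt_exp x).hasDerivWithinAt)
    Real.exp_injective.injOn φ
  simpa [Set.image_univ, Real.range_exp] using this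

theorem setLIntegral_Ioi_exp_neg_sq_div_two :
    ∫⁻ s in Set.Ioi 0, ENNReal.ofReal (Real.exp (-(s ^ 2 / 2))) =
      ENNReal.ofReal √(Real.pi / 2) := by
  have h := integral_gaussian_Ioi (1 / 2)
  have h2 := (integrable_exp_neg_mul_sq (b := 1 / 2) (by norm_num)).restrict (s := Set.Ioi 0)
  rw [show √(Real.pi / 2) = √(Real.pi / (1 / 2)) / 2 by
    rw [show Real.pi / (1 / 2) = 2 ^ 2 * (Real.pi / 2) by ring, Real.sqrt_mul (by norm_num),
      Real.sqrt_sq (by norm_num)]; ring, ← h, ofReal_integral_eq_lintegral_ofReal h2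
      (Filter.Eventually.of_forall fun x => (Real.exp_pos _).le)]
  congr with s
  congr 2; ring

/-- The one-dimensional functional Santaló inequality on half-lines. -/
theorem setLIntegral_Ioi_mul_le_pi_div_two {φ ψ : ℝ → ℝ≥0∞} (hφ : Measurable φ)
    (hψ : Measurable ψ)
    (H : ∀ s > 0, ∀ t > 0, φ s * ψ t ≤ ENNReal.ofReal (Real.exp (-(s * t)))) :
    (∫⁻ s in Set.Ioi 0, φ s) * ∫⁻ t in Set.Ioi 0, ψ t ≤ ENNReal.ofReal (Real.pi / 2) := by
  rw [setLIntegral_Ioi_eq_lintegral_comp_exp, setLIntegral_Ioi_eq_lintegral_comp_exp]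
  -- The majorant is `s * exp (-s² / 2)` at `s = exp m`. At a midpoint its square is `exp (a + b) *
  -- exp (-exp (a + b))`, exactly the bound given by `H`.
  refine (lintegral_mul_lintegral_le_sq_of_midpoint (M := 1)
    (h := fun m => Real.exp m * Real.exp (-(Real.exp m ^ 2 / 2))) (by fun_prop) (by fun_prop)
    (by fun_prop) (fun m => by simp only [Pi.zero_apply]; positivity) ?_ ?_).trans ?_
  · intro m
    rw [Real.exp_neg, ← div_eq_mul_inv, div_le_one (Real.exp_pos _)]
    nlinarith [Real.add_one_le_exp (Real.exp m ^ 2 / 2), sq_nonneg (Real.exp m - 1)]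
  · intro a b
    have h1 := H _ (Real.exp_pos a) _ (Real.exp_pos b)
    calc _ = ENNReal.ofReal (Real.exp a) * ENNReal.ofReal (Real.exp b) *
          (φ (Real.exp a) * ψ (Real.exp b)) := by ring
      _ ≤ ENNReal.ofReal (Real.exp a) * ENNReal.ofReal (Real.exp b) *
          ENNReal.ofReal (Real.exp (-(Real.exp a * Real.exp b))) := by gcongr
      _ = _ := by
        rw [← ENNReal.ofReal_mul (by positivity), ← ENNReal.ofReal_mul (by positivity),
          ← ENNReal.ofReal_pow (by positivity)]
        simp only [← Real.exp_add, ← Real.exp_nat_mul]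
        congr 2
        push_cast
        rw [show (2 : ℝ) * ((a + b) / 2) = a + b by ring]
        ring
  · have h2 := setLIntegral_Ioi_eq_lintegral_comp_exp
      fun s => ENNReal.ofReal (Real.exp (-(s ^ 2 / 2)))
    rw [setLIntegral_Ioi_exp_neg_sq_div_two] at h2
    simp_rw [ENNReal.ofReal_mul (Real.exp_pos _).le]
    rw [← h2, ← ENNReal.ofReal_pow (by positivity), Real.sq_sqrt (by positivity)]

/-! ### The functional Santaló property -/

/-- The functional Santaló inequality with constant `C` for the pairing `B`: if `f` has its
barycenter at the origin and `f x * g y ≤ exp (-B x y)` then `∫ f * ∫ g ≤ C`. -/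
def FunctionalSantalo {E : Type*} [NormedAddCommGroup E] [NormedSpace ℝ E] [MeasurableSpace E]
    (μ : Measure E) (B : E →L[ℝ] E →L[ℝ] ℝ) (C : ℝ≥0∞) : Prop :=
  ∀ f g : E → ℝ≥0∞, Measurable f → Measurable g → ∫⁻ x, f x ∂μ ≠ ∞ →
    Integrable (fun x => x) (μ.withDensity f) → ∫ x, x ∂(μ.withDensity f) = 0 →
    (∀ x y, f x * g y ≤ ENNReal.ofReal (Real.exp (-(B x y)))) →
    (∫⁻ x, f x ∂μ) * ∫⁻ y, g y ∂μ ≤ C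

theorem MeasureTheory.Measure.map_snd_withDensity_prod {α β : Type*} [MeasurableSpace α]
    [MeasurableSpace β] (ρ : Measure α) (μ : Measure β) [SFinite ρ] [SFinite μ]
    {g : α × β → ℝ≥0∞} (hg : Measurable g) :
    ((ρ.prod μ).withDensity g).map Prod.snd = μ.withDensity fun y => ∫⁻ t, g (t, y) ∂ρ := by
  ext s hs
  rw [Measure.map_apply measurable_snd hs, withDensity_apply _ (measurable_snd hs),
    withDensity_apply _ hs, ← lintegral_indicator (measurable_snd hs), ← lintegral_indicator hs,
    lintegral_prod_symm _ (hg.indicator (measurable_snd hs)).aemeasurable]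
  congr with y
  by_cases hy : y ∈ s <;> simp [Set.indicator, hy]

theorem MeasureTheory.MeasurePreserving.map_withDensity_comp {α β : Type*} [MeasurableSpace α]
    [MeasurableSpace β] {μ : Measure α} {ν : Measure β} {φ : α → β}
    (hφ : MeasurePreserving φ μ ν) {g : β → ℝ≥0∞} (hg : Measurable g) :
    (μ.withDensity (g ∘ φ)).map φ = ν.withDensity g := by
  ext s hs
  rw [Measure.map_apply hφ.measurable hs, withDensity_apply _ (hφ.measurable hs),
    withDensity_apply _ hs, ← hφ.setLIntegral_comp_preimage hs hg]
  rfl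

/-! ### Half-spaces, shears and tilts -/

section Step

set_option linter.unusedSectionVars false

variable {E : Type*} [NormedAddCommGroup E] [NormedSpace ℝ E] [MeasurableSpace E] [BorelSpace E]
  [FiniteDimensional ℝ E] {μ : Measure E} [SFinite μ] {B : E →L[ℝ] E →L[ℝ] ℝ} {C : ℝ≥0∞}

/-- For fixed `x` and `y`, the half-line inequality for `exp (B x y) * f (·, x)` and `g (·, y)`
bounds the product of the marginals by `π / 2 * exp (-B x y)`. So the marginals, one of them divided
by `π / 2`, form a dual pair on `E`; the marginal of `g` plays the centred role in `hS`. -/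
theorem FunctionalSantalo.half_space (hS : FunctionalSantalo μ B C) (hB : ∀ x y, B x y = B y x)
    {f g : ℝ × E → ℝ≥0∞} (hf : Measurable f) (hg : Measurable g)
    (hfin : ∫⁻ p, g p ∂((volume.restrict (Set.Ioi 0)).prod μ) ≠ ∞)
    (hint : Integrable Prod.snd (((volume.restrict (Set.Ioi 0)).prod μ).withDensity g))
    (hz : ∫ p, p.2 ∂(((volume.restrict (Set.Ioi 0)).prod μ).withDensity g) = 0)
    (H : ∀ s > 0, ∀ t > 0, ∀ x y,
      f (s, x) * g (t, y) ≤ ENNReal.ofReal (Real.exp (-(s * t + B x y)))) :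
    (∫⁻ p, f p ∂((volume.restrict (Set.Ioi 0)).prod μ)) *
      ∫⁻ p, g p ∂((volume.restrict (Set.Ioi 0)).prod μ) ≤ ENNReal.ofReal (Real.pi / 2) * C := by
  set ρ : Measure ℝ := volume.restrict (Set.Ioi 0)
  have hmap := Measure.map_snd_withDensity_prod ρ μ hg
  have hpi : 0 < Real.pi / 2 := by positivity
  have hpi0 : ENNReal.ofReal (Real.pi / 2) ≠ 0 := by simpa using hpi
  rw [lintegral_prod_symm _ hf.aemeasurable, lintegral_prod_symm _ hg.aemeasurable] at *
  have key := hS (fun y => ∫⁻ t, g (t, y) ∂ρ)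
    (fun x => (ENNReal.ofReal (Real.pi / 2))⁻¹ * ∫⁻ s, f (s, x) ∂ρ)
    hg.lintegral_prod_left' (hf.lintegral_prod_left'.const_mul _) hfin
    (by rw [← hmap]; exact (integrable_map_measure (by fun_prop) (by fun_prop)).2 hint)
    (by rw [← hmap, integral_map (by fun_prop) (by fun_prop)]; exact hz) ?_
  · rw [lintegral_const_mul _ hf.lintegral_prod_left'] at key
    calc _ = ENNReal.ofReal (Real.pi / 2) * ((∫⁻ y, ∫⁻ t, g (t, y) ∂ρ ∂μ) *
          ((ENNReal.ofReal (Real.pi / 2))⁻¹ * ∫⁻ x, ∫⁻ s, f (s, x) ∂ρ ∂μ)) := by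
          rw [mul_left_comm (∫⁻ y, ∫⁻ t, g (t, y) ∂ρ ∂μ), ← mul_assoc (ENNReal.ofReal _),
            ENNReal.mul_inv_cancel hpi0 (by simp), one_mul, mul_comm]
      _ ≤ _ := by gcongr
  · intro y x
    have h1 := setLIntegral_Ioi_mul_le_pi_div_two
      (φ := fun s => ENNReal.ofReal (Real.exp (B x y)) * f (s, x)) (ψ := fun t => g (t, y))
      (by fun_prop) (by fun_prop) (by
        intro s hs t ht
        rw [mul_assoc]
        refine (mul_le_mul_right (H s hs t ht x y) _).trans_eq ?_
        rw [← ENNReal.ofReal_mul (by positivity), ← Real.exp_add]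
        congr 2; ring)
    rw [lintegral_const_mul _ (by fun_prop), mul_assoc] at h1
    rw [hB y x, mul_left_comm]
    have e1 : ENNReal.ofReal (Real.exp (-(B x y))) * ENNReal.ofReal (Real.exp (B x y)) = 1 := by
      rw [← ENNReal.ofReal_mul (by positivity), ← Real.exp_add]; simp
    calc _ = (ENNReal.ofReal (Real.pi / 2))⁻¹ * ((ENNReal.ofReal (Real.exp (-(B x y))) *
          ENNReal.ofReal (Real.exp (B x y))) *
          ((∫⁻ s, f (s, x) ∂ρ) * ∫⁻ t, g (t, y) ∂ρ)) := by
          rw [e1, one_mul, mul_comm (∫⁻ t, g (t, y) ∂ρ)]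
      _ ≤ (ENNReal.ofReal (Real.pi / 2))⁻¹ * (ENNReal.ofReal (Real.exp (-(B x y))) *
          ENNReal.ofReal (Real.pi / 2)) := by
          rw [mul_assoc (ENNReal.ofReal (Real.exp (-(B x y))))]
          gcongr
      _ = _ := by
          rw [mul_left_comm, ENNReal.inv_mul_cancel hpi0 (by simp), mul_one]

/-- The sheared and exponentially tilted copy of `f` which is dual to the copy
`(t, y) ↦ g (c + t, y + z + t • w)` of `g`. -/
noncomputable def shearTilt (B : E →L[ℝ] E →L[ℝ] ℝ) (c : ℝ) (z w : E) (f : ℝ × E → ℝ≥0∞)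
    (p : ℝ × E) : ℝ≥0∞ :=
  f (p.1 - B p.2 w, p.2) * ENNReal.ofReal (Real.exp ((p.1 - B p.2 w) * c + B p.2 z))

theorem measurable_shearTilt (c : ℝ) (z w : E) {f : ℝ × E → ℝ≥0∞} (hf : Measurable f) :
    Measurable (shearTilt B c z w f) := by
  have h1 : Measurable fun x : E => B x w := by
    exact (B.flip w).measurable
  have h2 : Measurable fun x : E => B x z := by
    exact (B.flip z).measurable
  unfold shearTilt
  fun_prop

/-- The sign `ε = ±1` selects the half. When the changed variables are put into the pairing, the
shear term `ε * t * B x w` cancels, and what remains beyond `s * t + B x y` is `(ε * s - B x w) * c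
+ B x z`, the exponent of the tilt. Both changes of variables preserve measure. -/
theorem FunctionalSantalo.half_space_shear [μ.IsAddRightInvariant] [SigmaFinite μ]
    (hS : FunctionalSantalo μ B C)
    (hB : ∀ x y, B x y = B y x) {f g : ℝ × E → ℝ≥0∞} (hf : Measurable f) (hg : Measurable g)
    (H : ∀ p q : ℝ × E, f p * g q ≤ ENNReal.ofReal (Real.exp (-(p.1 * q.1 + B p.2 q.2))))
    {ε c : ℝ} (hε : ε * ε = 1) (z w : E) {ρ ρ' : Measure ℝ} [SFinite ρ] [SFinite ρ']
    (hρ : MeasurePreserving (fun s => ε * s) (volume.restrict (Set.Ioi 0)) ρ)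
    (hρ' : MeasurePreserving (fun t => c + ε * t) (volume.restrict (Set.Ioi 0)) ρ')
    (hfin : ∫⁻ q, g q ∂(ρ'.prod μ) ≠ ∞)
    (hint : Integrable (fun q : ℝ × E => q.2 - z - (q.1 - c) • w) ((ρ'.prod μ).withDensity g))
    (hz : ∫ q, (q.2 - z - (q.1 - c) • w) ∂((ρ'.prod μ).withDensity g) = 0) :
    (∫⁻ p, shearTilt B c z w f p ∂(ρ.prod μ)) * ∫⁻ q, g q ∂(ρ'.prod μ) ≤
      ENNReal.ofReal (Real.pi / 2) * C := by
  have hΨ : MeasurePreserving (fun p : ℝ × E => (ε * p.1, p.2))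
      ((volume.restrict (Set.Ioi 0)).prod μ) (ρ.prod μ) :=
    hρ.prod (MeasurePreserving.id μ)
  have hΦ : MeasurePreserving (fun p : ℝ × E => (c + ε * p.1, p.2 + (z + (ε * p.1) • w)))
      ((volume.restrict (Set.Ioi 0)).prod μ) (ρ'.prod μ) :=
    hρ'.skew_product (g := fun t y => y + (z + (ε * t) • w)) (by fun_prop)
      (Filter.Eventually.of_forall fun t => map_add_right_eq_self μ _)
  have hmap := hΦ.map_withDensity_comp hg
  have hsnd : (Prod.snd : ℝ × E → E) = (fun q : ℝ × E => q.2 - z - (q.1 - c) • w) ∘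
      fun p : ℝ × E => (c + ε * p.1, p.2 + (z + (ε * p.1) • w)) := by
    ext p
    simp only [Function.comp_apply, add_sub_cancel_left]
    abel
  rw [← hmap] at hint hz
  rw [integral_map hΦ.measurable.aemeasurable (by fun_prop)] at hz
  rw [integrable_map_measure (by fun_prop) hΦ.measurable.aemeasurable, ← hsnd] at hint
  rw [← hΦ.lintegral_comp hg] at hfin ⊢
  rw [← hΨ.lintegral_comp (measurable_shearTilt c z w hf)]
  refine hS.half_space hB ((measurable_shearTilt c z w hf).comp hΨ.measurable)
    (hg.comp hΦ.measurable) hfin hint ?_ ?_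
  · rw [← hz]
    congr 1
  · intro s hs t ht x y
    have h1 := H (ε * s - B x w, x) (c + ε * t, y + (z + (ε * t) • w))
    calc _ = f (ε * s - B x w, x) * g (c + ε * t, y + (z + (ε * t) • w)) *
          ENNReal.ofReal (Real.exp ((ε * s - B x w) * c + B x z)) := by
          simp only [shearTilt]; ring
      _ ≤ _ := mul_le_mul_left h1 _
      _ = _ := by
          rw [← ENNReal.ofReal_mul (by positivity), ← Real.exp_add]
          congr 2
          simp only [map_add, map_smul, smul_eq_mul]
          linear_combination (-s * t) * hε

/-- For fixed `x` the shear is a translation of the first coordinate. -/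
theorem lintegral_shearTilt (c : ℝ) (z w : E) {f : ℝ × E → ℝ≥0∞} (hf : Measurable f) :
    ∫⁻ p, shearTilt B c z w f p ∂(volume.prod μ) =
      ∫⁻ p, f p * ENNReal.ofReal (Real.exp (p.1 * c + B p.2 z)) ∂(volume.prod μ) := by
  have h2 : Measurable fun x : E => B x z := (B.flip z).measurable
  rw [lintegral_prod_symm _ (measurable_shearTilt c z w hf).aemeasurable,
    lintegral_prod_symm _ (by fun_prop)]
  congr with x
  exact lintegral_sub_right_eq_self
    (fun s => f (s, x) * ENNReal.ofReal (Real.exp (s * c + B x z))) (B x w)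

/-- Integrate `1 + L ≤ exp L`: the linear term vanishes against a centred density. -/
theorem lintegral_le_lintegral_mul_exp {F : Type*} [NormedAddCommGroup F] [NormedSpace ℝ F]
    [CompleteSpace F]
    [MeasurableSpace F] [BorelSpace F] {μ : Measure F} {f : F → ℝ≥0∞} (hf : Measurable f)
    (hfin : ∫⁻ x, f x ∂μ ≠ ∞) (hint : Integrable (fun x => x) (μ.withDensity f))
    (hz : ∫ x, x ∂(μ.withDensity f) = 0) (L : F →L[ℝ] ℝ) :
    ∫⁻ x, f x ∂μ ≤ ∫⁻ x, f x * ENNReal.ofReal (Real.exp (L x)) ∂μ := by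
  have : IsFiniteMeasure (μ.withDensity f) := isFiniteMeasure_withDensity hfin
  have hL : Integrable (fun x => L x) (μ.withDensity f) := L.integrable_comp hint
  have h1 : ∫ x, (1 + L x) ∂(μ.withDensity f) = (μ.withDensity f).real Set.univ := by
    rw [integral_add (integrable_const _) hL, L.integral_comp_comm hint, hz]
    simp
  calc ∫⁻ x, f x ∂μ = ENNReal.ofReal (∫ x, (1 + L x) ∂(μ.withDensity f)) := by
        rw [h1, measureReal_def, ENNReal.ofReal_toReal (measure_ne_top _ _)]
        simp
    _ ≤ ∫⁻ x, ENNReal.ofReal (1 + L x) ∂(μ.withDensity f) :=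
        by
        have h2 : Integrable (fun x => 1 + L x) (μ.withDensity f) := (integrable_const _).add hL
        rw [integral_eq_lintegral_pos_part_sub_lintegral_neg_part h2]
        exact (ENNReal.ofReal_le_ofReal (sub_le_self _ ENNReal.toReal_nonneg)).trans
          ENNReal.ofReal_toReal_le
    _ ≤ ∫⁻ x, ENNReal.ofReal (Real.exp (L x)) ∂(μ.withDensity f) := by
        gcongr with x
        linarith [Real.add_one_le_exp (L x)]
    _ = _ := lintegral_withDensity_eq_lintegral_mul _ hf (by fun_prop)

end Step

/-! ### Medians -/

theorem MeasureTheory.measure_Iio_le_of_forall_Iic_le {m : Measure ℝ} {c : ℝ} {K : ℝ≥0∞}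
    (h : ∀ d < c, m (Set.Iic d) ≤ K) : m (Set.Iio c) ≤ K := by
  obtain ⟨u, hu, huc, hlim⟩ := exists_seq_strictMono_tendsto c
  have : Set.Iio c = ⋃ n, Set.Iic (u n) := by
    ext x
    simp only [Set.mem_Iio, Set.mem_iUnion, Set.mem_Iic]
    refine ⟨fun hx => ?_, fun ⟨n, hn⟩ => hn.trans_lt (huc n)⟩
    obtain ⟨n, hn⟩ := (hlim.eventually (lt_mem_nhds hx)).exists
    exact ⟨n, hn.le⟩
  rw [this, Monotone.measure_iUnion fun i j hij => Set.Iic_subset_Iic.2 (hu.monotone hij)]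
  exact iSup_le fun n => h _ (huc n)

theorem MeasureTheory.measure_Ioi_le_of_forall_Ioi_le {m : Measure ℝ} {c : ℝ} {K : ℝ≥0∞}
    (h : ∀ d > c, m (Set.Ioi d) ≤ K) : m (Set.Ioi c) ≤ K := by
  obtain ⟨u, hu, huc, hlim⟩ := exists_seq_strictAnti_tendsto c
  have : Set.Ioi c = ⋃ n, Set.Ioi (u n) := by
    ext x
    simp only [Set.mem_Ioi, Set.mem_iUnion]
    refine ⟨fun hx => ?_, fun ⟨n, hn⟩ => (huc n).trans hn⟩
    exact (hlim.eventually (gt_mem_nhds hx)).exists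
  rw [this, Monotone.measure_iUnion fun i j hij => Set.Ioi_subset_Ioi (hu.antitone hij)]
  exact iSup_le fun n => h _ (huc n)

/-- Existence of a median for a finite measure without atoms. -/
theorem MeasureTheory.exists_measure_Ioi_eq_half (m : Measure ℝ) [IsFiniteMeasure m] [NullSingletonClass m] :
    ∃ c, m (Set.Ioi c) = m Set.univ / 2 ∧ m (Set.Iio c) = m Set.univ / 2 := by
  rcases eq_or_ne (m Set.univ) 0 with h0 | h0
  · refine ⟨0, ?_, ?_⟩ <;>
    · rw [h0, ENNReal.zero_div]
      exact measure_mono_null (Set.subset_univ _) h0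
  set M := m Set.univ with hM
  have hMt : M ≠ ∞ := measure_ne_top _ _
  have hsplit : ∀ c, m (Set.Iic c) + m (Set.Ioi c) = M := fun c => by
    rw [← Set.compl_Iic]; exact measure_add_measure_compl measurableSet_Iic
  have hhalf : M / 2 + M / 2 = M := ENNReal.add_halves M
  have hhalf_lt : M / 2 < M := ENNReal.half_lt_self h0 hMt
  -- At `sSup S` both open tails have mass at most `M / 2`; without atoms they add up to `M`, so
  -- both are equal to `M / 2`.
  set S := {c | m (Set.Iic c) ≤ M / 2} with hS
  have hne : S.Nonempty := by
    obtain ⟨d, hd⟩ := ((tendsto_measure_Ici_atBot m).eventually (lt_mem_nhds hhalf_lt)).exists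
    refine ⟨d - 1, ?_⟩
    have h1 : m (Set.Iic (d - 1)) ≤ m (Set.Iio d) :=
      measure_mono (Set.Iic_subset_Iio.2 (by linarith))
    have h2 : m (Set.Iio d) + m (Set.Ici d) = M := by
      rw [← Set.compl_Iio]; exact measure_add_measure_compl measurableSet_Iio
    refine h1.trans ?_
    by_contra! h4
    have := ENNReal.add_lt_add h4 hd
    rw [hhalf, h2] at this
    exact lt_irrefl _ this
  have hbdd : BddAbove S := by
    have := (tendsto_measure_Iic_atTop m).eventually (lt_mem_nhds hhalf_lt)
    obtain ⟨d, hd⟩ := this.exists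
    refine ⟨d, fun c hc => ?_⟩
    by_contra! hlt
    exact absurd ((measure_mono (Set.Iic_subset_Iic.2 hlt.le)).trans hc) (not_le.2 hd)
  have h1 : m (Set.Iio (sSup S)) ≤ M / 2 := by
    refine measure_Iio_le_of_forall_Iic_le fun d hd => ?_
    obtain ⟨e, he, hde⟩ := exists_lt_of_lt_csSup hne hd
    exact (measure_mono (Set.Iic_subset_Iic.2 hde.le)).trans he
  have h2 : m (Set.Ioi (sSup S)) ≤ M / 2 := by
    refine measure_Ioi_le_of_forall_Ioi_le fun d hd => ?_
    have h3 : M / 2 < m (Set.Iic d) := by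
      by_contra! h
      exact absurd (le_csSup hbdd h) (not_le.2 hd)
    by_contra! h4
    have := ENNReal.add_lt_add h3 h4
    rw [hhalf, hsplit] at this
    exact lt_irrefl _ this
  have h3 := hsplit (sSup S)
  rw [← measure_congr (Iio_ae_eq_Iic (μ := m))] at h3
  have hht : M / 2 ≠ ∞ := ne_top_of_lt hhalf_lt
  refine ⟨sSup S, le_antisymm h2 ?_, le_antisymm h1 ?_⟩
  · refine (ENNReal.add_le_add_iff_left hht).1 ?_
    rw [hhalf]
    refine h3.ge.trans ?_
    gcongr
  · refine (ENNReal.add_le_add_iff_right hht).1 ?_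
    rw [hhalf]
    refine h3.ge.trans ?_
    gcongr

/-! ### The induction step on the dimension -/

section Step

set_option linter.unusedSectionVars false

variable {E : Type*} [NormedAddCommGroup E] [NormedSpace ℝ E] [MeasurableSpace E] [BorelSpace E]
  [FiniteDimensional ℝ E] {μ : Measure E} [SigmaFinite μ] {B : E →L[ℝ] E →L[ℝ] ℝ} {C : ℝ≥0∞}

/-- Translation and shear parameters that centre the two halves of a measure on `ℝ × E`. -/
theorem exists_shear_centering {νp νm : Measure (ℝ × E)} [IsFiniteMeasure νp] [IsFiniteMeasure νm]
    {c : ℝ} (hp : Integrable (fun q => q) νp) (hm : Integrable (fun q => q) νm)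
    (hp0 : νp ≠ 0) (hm0 : νm ≠ 0) (hmass : νp Set.univ = νm Set.univ)
    (hpc : ∀ᵐ q ∂νp, c < q.1) (hmc : ∀ᵐ q ∂νm, q.1 < c) :
    ∃ z w : E, ∫ q, (q.2 - z - (q.1 - c) • w) ∂νp = 0 ∧
      ∫ q, (q.2 - z - (q.1 - c) • w) ∂νm = 0 := by
  set a := νp.real Set.univ with ha
  have ha' : νm.real Set.univ = a := by rw [ha, measureReal_def, measureReal_def, hmass]
  have ha0 : a ≠ 0 := by
    rw [ha, measureReal_def]
    exact (ENNReal.toReal_pos (by simpa using hp0) (measure_ne_top _ _)).ne'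
  have hint : ∀ ν : Measure (ℝ × E), IsFiniteMeasure ν → Integrable (fun q => q) ν →
      Integrable (fun q : ℝ × E => q.1 - c) ν := fun ν _ h => h.fst.sub (integrable_const c)
  have hformula : ∀ ν : Measure (ℝ × E), IsFiniteMeasure ν → Integrable (fun q => q) ν →
      ∀ z w : E, ∫ q, (q.2 - z - (q.1 - c) • w) ∂ν =
        (∫ q, q.2 ∂ν) - ν.real Set.univ • z - (∫ q, (q.1 - c) ∂ν) • w := by
    intro ν hν h z w
    have h1 : Integrable (fun q : ℝ × E => q.2 - z) ν := h.snd.sub (integrable_const z)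
    rw [integral_sub h1 ((hint ν hν h).smul_const w),
      integral_sub h.snd (integrable_const z), integral_smul_const, integral_const]
  have hppos : 0 < ∫ q, (q.1 - c) ∂νp := by
    have h0 : 0 ≤ᵐ[νp] fun q => q.1 - c := by
      filter_upwards [hpc] with q hq using sub_nonneg.2 hq.le
    refine lt_of_le_of_ne (integral_nonneg_of_ae h0) fun h => ?_
    have h1 := (integral_eq_zero_iff_of_nonneg_ae h0 (hint νp ‹_› hp)).1 h.symm
    have : ∀ᵐ q ∂νp, False := by
      filter_upwards [hpc, h1] with q hq hq1
      simp only [Pi.zero_apply] at hq1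
      linarith
    simp [hp0] at this
  have hmneg : ∫ q, (q.1 - c) ∂νm < 0 := by
    have h0 : 0 ≤ᵐ[νm] fun q => -(q.1 - c) := by
      filter_upwards [hmc] with q hq using by simp only [Pi.zero_apply]; linarith
    have h2 : 0 ≤ ∫ q, -(q.1 - c) ∂νm := integral_nonneg_of_ae h0
    rw [integral_neg] at h2
    refine lt_of_le_of_ne (by linarith) fun h => ?_
    have h1 := (integral_eq_zero_iff_of_nonneg_ae h0 (hint νm ‹_› hm).neg).1
      (by rw [integral_neg, h, neg_zero])
    have : ∀ᵐ q ∂νm, False := by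
      filter_upwards [hmc, h1] with q hq hq1
      simp only [Pi.zero_apply] at hq1
      linarith
    simp [hm0] at this
  set P := ∫ q, (q.1 - c) ∂νp
  set N := ∫ q, (q.1 - c) ∂νm
  have hPN : P - N ≠ 0 := by linarith
  -- The two conditions read `∫ q.2 = a • z + P • w` over `νp` and `∫ q.2 = a • z + N • w` over
  -- `νm`. Equal masses make `z` drop out of the difference, which gives `w` because `N < 0 < P`.
  set w : E := (P - N)⁻¹ • ((∫ q, q.2 ∂νp) - ∫ q, q.2 ∂νm) with hw
  have hw' : (∫ q, q.2 ∂νp) - ∫ q, q.2 ∂νm = (P - N) • w := by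
    rw [hw, smul_inv_smul₀ hPN]
  refine ⟨a⁻¹ • ((∫ q, q.2 ∂νp) - P • w), w, ?_, ?_⟩
  · rw [hformula νp ‹_› hp, ← ha, smul_inv_smul₀ ha0]
    abel
  · rw [hformula νm ‹_› hm, ha', smul_inv_smul₀ ha0]
    have h1 : ∫ q, q.2 ∂νm = (∫ q, q.2 ∂νp) - (P - N) • w := by rw [← hw']; abel
    rw [h1, sub_smul]
    abel

/-- The pairing `s * t + B x y` on `ℝ × E`. -/
noncomputable def prodPairing (B : E →L[ℝ] E →L[ℝ] ℝ) :
    (ℝ × E) →L[ℝ] (ℝ × E) →L[ℝ] ℝ :=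
  (ContinuousLinearMap.mul ℝ ℝ).bilinearComp (.fst ℝ ℝ E) (.fst ℝ ℝ E) +
    B.bilinearComp (.snd ℝ ℝ E) (.snd ℝ ℝ E)

theorem prodPairing_apply (p q : ℝ × E) : prodPairing B p q = p.1 * q.1 + B p.2 q.2 := rfl

theorem MeasureTheory.measurePreserving_restrict_Iio_sub (c : ℝ) :
    MeasurePreserving (fun t => c + (-1) * t) (volume.restrict (Set.Ioi 0))
      (volume.restrict (Set.Iio c)) := by
  have h := ((measurePreserving_add_left (volume : Measure ℝ) c).comp
    (Measure.measurePreserving_neg volume)).restrict_preimage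
    (measurableSet_Iio (a := c))
  simpa [Set.preimage, Set.Ioi, Function.comp_def] using h

theorem MeasureTheory.measurePreserving_restrict_Ioi_add (c : ℝ) :
    MeasurePreserving (fun t => c + 1 * t) (volume.restrict (Set.Ioi 0))
      (volume.restrict (Set.Ioi c)) := by
  have h := (measurePreserving_add_left (volume : Measure ℝ) c).restrict_preimage
    (measurableSet_Ioi (a := c))
  simpa [Set.preimage, Set.Ioi] using h

theorem MeasureTheory.restrict_Ioi_add_restrict_Iio (c : ℝ) :
    (volume.restrict (Set.Ioi c) + volume.restrict (Set.Iio c) : Measure ℝ) = volume := by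
  rw [Measure.restrict_congr_set (Iio_ae_eq_Iic (μ := volume)), ← Set.compl_Ioi]
  exact Measure.restrict_add_restrict_compl measurableSet_Ioi

/-- The cut of `g` is at a median of its first marginal; the tilted `f` is cut at `0`. -/
theorem FunctionalSantalo.prod_of_integrable [μ.IsAddRightInvariant]
    (hS : FunctionalSantalo μ B C) (hB : ∀ x y, B x y = B y x) {f g : ℝ × E → ℝ≥0∞}
    (hf : Measurable f) (hg : Measurable g)
    (hfin : ∫⁻ p, f p ∂(volume.prod μ) ≠ ∞)
    (hint : Integrable (fun p => p) ((volume.prod μ).withDensity f))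
    (hz : ∫ p, p ∂((volume.prod μ).withDensity f) = 0)
    (hgfin : ∫⁻ p, g p ∂(volume.prod μ) ≠ ∞)
    (hgint : Integrable (fun p => p) ((volume.prod μ).withDensity g))
    (H : ∀ p q : ℝ × E, f p * g q ≤ ENNReal.ofReal (Real.exp (-(p.1 * q.1 + B p.2 q.2)))) :
    (∫⁻ p, f p ∂(volume.prod μ)) * ∫⁻ q, g q ∂(volume.prod μ) ≤
      ENNReal.ofReal (2 * Real.pi) * C := by
  rcases eq_or_ne (∫⁻ q, g q ∂(volume.prod μ)) 0 with hg0 | hg0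
  · simp [hg0]
  set G := ∫⁻ q, g q ∂(volume.prod μ) with hG
  set Λ : Measure (ℝ × E) := volume.prod μ with hΛ
  set ν := Λ.withDensity g with hν
  have hνu : ν Set.univ = G := by simp [hν, hG]
  have : IsFiniteMeasure ν := isFiniteMeasure_withDensity hgfin
  have hatoms : NullSingletonClass (ν.map Prod.fst) := by
    refine ⟨fun x => ?_⟩
    rw [Measure.map_apply measurable_fst (measurableSet_singleton x)]
    refine withDensity_absolutelyContinuous _ _ ?_
    rw [← Set.prod_univ, Measure.prod_prod]
    simp
  obtain ⟨c, hc1, hc2⟩ := exists_measure_Ioi_eq_half (ν.map Prod.fst)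
  rw [Measure.map_apply measurable_fst measurableSet_Ioi,
    Measure.map_apply measurable_fst MeasurableSet.univ, Set.preimage_univ, hνu] at hc1
  rw [Measure.map_apply measurable_fst measurableSet_Iio,
    Measure.map_apply measurable_fst MeasurableSet.univ, Set.preimage_univ, hνu] at hc2
  have hres : ∀ s : Set ℝ, MeasurableSet s →
      ((volume.restrict s).prod μ).withDensity g = ν.restrict (Prod.fst ⁻¹' s) := by
    intro s hs
    rw [hν, restrict_withDensity (measurable_fst hs), ← Set.prod_univ, hΛ,
      ← Measure.prod_restrict, Measure.restrict_univ]
  have hlint : ∀ s : Set ℝ, MeasurableSet s →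
      ∫⁻ q, g q ∂((volume.restrict s).prod μ) = ν (Prod.fst ⁻¹' s) := by
    intro s hs
    have := congrArg (fun m => m Set.univ) (hres s hs)
    simpa using this
  have hG2 : G / 2 ≠ 0 := by simpa using hg0
  have hG2t : G / 2 ≠ ∞ := ENNReal.div_ne_top hgfin (by simp)
  obtain ⟨z, w, hzp, hzm⟩ := exists_shear_centering (c := c)
    (νp := ν.restrict (Prod.fst ⁻¹' Set.Ioi c)) (νm := ν.restrict (Prod.fst ⁻¹' Set.Iio c))
    hgint.restrict hgint.restrict
    (by rw [Ne, Measure.restrict_eq_zero, hc1]; exact hG2)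
    (by rw [Ne, Measure.restrict_eq_zero, hc2]; exact hG2)
    (by rw [Measure.restrict_apply_univ, Measure.restrict_apply_univ, hc1, hc2])
    (ae_restrict_mem (measurable_fst measurableSet_Ioi))
    (ae_restrict_mem (measurable_fst measurableSet_Iio))
  have hint' : Integrable (fun q : ℝ × E => q.2 - z - (q.1 - c) • w) ν :=
    (hgint.snd.sub (integrable_const z)).sub
      ((hgint.fst.sub (integrable_const c)).smul_const w)
  have hp := hS.half_space_shear hB hf hg H (ε := 1) (c := c) (by norm_num) z w
    (by simpa using measurePreserving_restrict_Ioi_add 0)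
    (measurePreserving_restrict_Ioi_add c)
    (by rw [hlint _ measurableSet_Ioi, hc1]; exact hG2t)
    (by rw [hres _ measurableSet_Ioi]; exact hint'.restrict)
    (by rw [hres _ measurableSet_Ioi]; exact hzp)
  have hm := hS.half_space_shear hB hf hg H (ε := -1) (c := c) (by norm_num) z w
    (by simpa only [zero_add] using measurePreserving_restrict_Iio_sub 0)
    (measurePreserving_restrict_Iio_sub c)
    (by rw [hlint _ measurableSet_Iio, hc2]; exact hG2t)
    (by rw [hres _ measurableSet_Iio]; exact hint'.restrict)
    (by rw [hres _ measurableSet_Iio]; exact hzm)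
  rw [hlint _ measurableSet_Ioi, hc1] at hp
  rw [hlint _ measurableSet_Iio, hc2] at hm
  -- Both halves use the same `c`, `z`, `w`, so the two integrals are those of one tilted function
  -- over complementary half-spaces, with the common factor `G / 2`.
  have hsum : (∫⁻ p, shearTilt B c z w f p ∂Λ) * (G / 2) ≤ ENNReal.ofReal Real.pi * C := by
    have e : Λ = (volume.restrict (Set.Ioi 0)).prod μ + (volume.restrict (Set.Iio 0)).prod μ := by
      rw [← Measure.add_prod, restrict_Ioi_add_restrict_Iio]
    rw [e, lintegral_add_measure, add_mul]
    refine (add_le_add hp hm).trans_eq ?_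
    rw [← add_mul, ← ENNReal.ofReal_add (by positivity) (by positivity), add_halves]
  have hle : ∫⁻ p, f p ∂Λ ≤ ∫⁻ p, shearTilt B c z w f p ∂Λ := by
    rw [hΛ, lintegral_shearTilt c z w hf]
    refine (lintegral_le_lintegral_mul_exp hf hfin hint hz
      (c • ContinuousLinearMap.fst ℝ ℝ E + (B.flip z).comp (.snd ℝ ℝ E))).trans_eq ?_
    simp [mul_comm c, hΛ]
  calc (∫⁻ p, f p ∂Λ) * G ≤ (∫⁻ p, shearTilt B c z w f p ∂Λ) * G := by gcongr
    _ = 2 * ((∫⁻ p, shearTilt B c z w f p ∂Λ) * (G / 2)) := by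
      rw [mul_left_comm, ENNReal.mul_div_cancel (by simp) (by simp)]
    _ ≤ 2 * (ENNReal.ofReal Real.pi * C) := by gcongr
    _ = _ := by rw [ENNReal.ofReal_mul (by simp), mul_assoc]; simp

/-- Truncating `g` in height and support preserves the duality bound and gives finite mass and first
moment; monotone convergence recovers `g`. -/
theorem FunctionalSantalo.prod [μ.IsAddRightInvariant] [IsFiniteMeasureOnCompacts μ]
    (hS : FunctionalSantalo μ B C) (hB : ∀ x y, B x y = B y x) :
    FunctionalSantalo (volume.prod μ) (prodPairing B) (ENNReal.ofReal (2 * Real.pi) * C) := by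
  intro f g hf hg hfin hint hz H
  set Λ : Measure (ℝ × E) := volume.prod μ with hΛ
  set gN : ℕ → ℝ × E → ℝ≥0∞ := fun N =>
    (Metric.closedBall 0 N).indicator fun p => min (g p) N with hgN
  have hgNm : ∀ N, Measurable (gN N) := fun N =>
    (hg.min measurable_const).indicator Metric.isClosed_closedBall.measurableSet
  have hgNle : ∀ N p, gN N p ≤ g p := fun N p =>
    Set.indicator_le' (fun _ _ => min_le_left _ _) (fun _ _ => zero_le) p
  have hmono : Monotone gN := by
    intro M N hMN p
    have hsub : Metric.closedBall (0 : ℝ × E) M ⊆ Metric.closedBall 0 N :=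
      Metric.closedBall_subset_closedBall (by exact_mod_cast hMN)
    refine (Set.indicator_le_indicator_of_subset hsub (fun _ => zero_le) p).trans
      (Set.indicator_le_indicator ?_)
    gcongr
  have hsup : ∀ p, ⨆ N, gN N p = g p := by
    intro p
    refine le_antisymm (iSup_le fun N => hgNle N p) (le_of_forall_lt fun r hr => ?_)
    obtain ⟨N₁, hN₁⟩ := ENNReal.exists_nat_gt (ne_top_of_lt hr)
    obtain ⟨N₂, hN₂⟩ := exists_nat_ge ‖p‖
    refine lt_iSup_iff.2 ⟨max N₁ N₂, ?_⟩
    have : p ∈ Metric.closedBall (0 : ℝ × E) ((max N₁ N₂ : ℕ) : ℝ) := by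
      rw [mem_closedBall_zero_iff]
      exact hN₂.trans (by exact_mod_cast le_max_right _ _)
    simp only [hgN, Set.indicator_of_mem this]
    exact lt_min hr (hN₁.trans_le (by exact_mod_cast le_max_left _ _))
  have hlim : ∫⁻ q, g q ∂Λ = ⨆ N, ∫⁻ q, gN N q ∂Λ := by
    rw [← lintegral_iSup hgNm hmono]
    simp_rw [hsup]
  rw [hlim, ENNReal.mul_iSup]
  refine iSup_le fun N => ?_
  have hball : Λ (Metric.closedBall 0 N) < ∞ := (isCompact_closedBall 0 (N : ℝ)).measure_lt_top
  have hNfin : ∫⁻ q, gN N q ∂Λ ≠ ∞ := by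
    refine ne_top_of_le_ne_top (b := N * Λ (Metric.closedBall 0 N))
      (ENNReal.mul_ne_top (by simp) hball.ne) ?_
    rw [lintegral_indicator Metric.isClosed_closedBall.measurableSet, ← setLIntegral_const]
    exact lintegral_mono fun _ => min_le_right _ _
  have : IsFiniteMeasure (Λ.withDensity (gN N)) := isFiniteMeasure_withDensity hNfin
  refine hS.prod_of_integrable hB hf (hgNm N) hfin hint hz hNfin ?_ fun p q =>
    (mul_le_mul_right (hgNle N q) _).trans (H p q)
  refine Integrable.of_bound (by fun_prop) N ?_
  rw [ae_withDensity_iff (hgNm N)]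
  refine Filter.Eventually.of_forall fun p hp => ?_
  simpa using Set.mem_of_indicator_ne_zero hp

end Step

/-! ### Transport to Euclidean space -/

theorem FunctionalSantalo.map {E F : Type*} [NormedAddCommGroup E] [NormedSpace ℝ E]
    [MeasurableSpace E] [BorelSpace E] [CompleteSpace E] [SecondCountableTopology E]
    [NormedAddCommGroup F] [NormedSpace ℝ F]
    [MeasurableSpace F] [BorelSpace F] [CompleteSpace F] [SecondCountableTopology F]
    {μ : Measure E} {ν : Measure F}
    {B : E →L[ℝ] E →L[ℝ] ℝ} {B' : F →L[ℝ] F →L[ℝ] ℝ} {C : ℝ≥0∞}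
    (hS : FunctionalSantalo μ B C) (e : E ≃L[ℝ] F) (he : MeasurePreserving e μ ν)
    (hB : ∀ x y, B' (e x) (e y) = B x y) : FunctionalSantalo ν B' C := by
  intro f g hf hg hfin hint hz H
  have hem : Measurable e := he.measurable
  rw [← he.map_withDensity_comp hf] at hint hz
  rw [integrable_map_measure (by fun_prop) (by fun_prop)] at hint
  rw [integral_map (by fun_prop) (by fun_prop)] at hz
  rw [← he.lintegral_comp hf] at hfin ⊢
  rw [← he.lintegral_comp hg]
  have h1 : Integrable (fun x => x) (μ.withDensity (f ∘ e)) := by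
    simpa [Function.comp_def] using (e.symm : F →L[ℝ] E).integrable_comp hint
  refine hS _ _ (hf.comp hem) (hg.comp hem) hfin h1 ?_ fun x y => ?_
  · have h2 := (e : E →L[ℝ] F).integral_comp_comm h1
    have h3 : e (∫ x, x ∂(μ.withDensity (f ∘ e))) = 0 := by
      rw [← hz]; exact h2.symm
    exact e.map_eq_zero_iff.1 h3
  · rw [← hB]; exact H _ _

/-- The linear identification of `ℝ × ℝⁿ` with `ℝⁿ⁺¹`. -/
noncomputable def EuclideanSpace.consEquivL (n : ℕ) :
    (ℝ × EuclideanSpace ℝ (Fin n)) ≃L[ℝ] EuclideanSpace ℝ (Fin (n + 1)) :=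
  ((ContinuousLinearEquiv.refl ℝ ℝ).prodCongr (PiLp.continuousLinearEquiv 2 ℝ fun _ => ℝ)).trans
    ((Fin.consEquivL ℝ fun _ : Fin (n + 1) => ℝ).trans
      (PiLp.continuousLinearEquiv 2 ℝ fun _ => ℝ).symm)

theorem EuclideanSpace.measurePreserving_consEquivL (n : ℕ) :
    MeasurePreserving (EuclideanSpace.consEquivL n) (volume.prod volume) volume := by
  have h1 : MeasurePreserving (Prod.map id (WithLp.ofLp (p := 2) (V := Fin n → ℝ)))
      ((volume : Measure ℝ).prod volume) (volume.prod volume) :=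
    (MeasurePreserving.id volume).prod (PiLp.volume_preserving_ofLp (Fin n))
  have h2 := (volume_preserving_piFinSuccAbove (fun _ : Fin (n + 1) => ℝ) 0).symm
  have h3 := (PiLp.volume_preserving_toLp (Fin (n + 1))).comp (h2.comp h1)
  refine h3.congr (EuclideanSpace.consEquivL n).continuous.measurable
    (Filter.Eventually.of_forall fun p => ?_)
  refine (WithLp.ofLp_injective 2) (funext fun i => ?_)
  refine Fin.cases ?_ (fun j => ?_) i <;>
  simp [EuclideanSpace.consEquivL, MeasurableEquiv.piFinSuccAbove]

theorem EuclideanSpace.inner_consEquivL {n : ℕ} (p q : ℝ × EuclideanSpace ℝ (Fin n)) :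
    inner ℝ (EuclideanSpace.consEquivL n p) (EuclideanSpace.consEquivL n q) =
      p.1 * q.1 + inner ℝ p.2 q.2 := by
  simp [EuclideanSpace.consEquivL, PiLp.inner_apply, Fin.sum_univ_succ, mul_comm]

/-- The functional Santaló inequality on `ℝⁿ`. -/
theorem functionalSantalo_euclideanSpace (n : ℕ) :
    FunctionalSantalo (volume : Measure (EuclideanSpace ℝ (Fin n))) (innerSL ℝ)
      (ENNReal.ofReal (2 * Real.pi) ^ n) := by
  induction n with
  | zero =>
    -- The space is a single point, and the claim is the duality bound there.
    intro f g hf hg _ _ _ H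
    have := H 0 0
    simpa [volume_euclideanSpace_eq_dirac, lintegral_dirac' _ hf, lintegral_dirac' _ hg] using this
  | succ n ih =>
    rw [pow_succ']
    refine (ih.prod fun x y => real_inner_comm y x).map (EuclideanSpace.consEquivL n)
      (EuclideanSpace.measurePreserving_consEquivL n) fun p q => ?_
    rw [prodPairing_apply]
    exact EuclideanSpace.inner_consEquivL p q

/-! ### The Rayleigh measure -/

/-- The radial measure `r * exp (-r² / 2) dr` on `(0, ∞)`. -/
noncomputable def rayleigh : Measure ℝ :=
  (volume.restrict (Set.Ioi 0)).withDensity fun r =>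
    ENNReal.ofReal (r * Real.exp (-(r ^ 2 / 2)))

theorem measurable_rayleigh_density :
    Measurable fun r : ℝ => ENNReal.ofReal (r * Real.exp (-(r ^ 2 / 2))) := by
  fun_prop

theorem rayleigh_ae_pos : ∀ᵐ r ∂rayleigh, 0 < r :=
  (withDensity_absolutelyContinuous _ _).ae_le (ae_restrict_mem measurableSet_Ioi)

/-- This tail motivates the density: for a star-shaped body `K`, the `r > 0` with `r⁻¹ • x ∈ K` are
those with `‖x‖_K ≤ r`, of measure `exp (-‖x‖_K² / 2)`. -/
theorem rayleigh_Ici {a : ℝ} (ha : 0 ≤ a) :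
    rayleigh (Set.Ici a) = ENNReal.ofReal (Real.exp (-(a ^ 2 / 2))) := by
  have hd : ∀ x ∈ Set.Ici a, HasDerivAt (fun r => -Real.exp (-(r ^ 2 / 2)))
      (x * Real.exp (-(x ^ 2 / 2))) x := by
    intro x _
    have h1 : HasDerivAt (fun r : ℝ => -(r ^ 2 / 2)) (-x) x := by
      have := ((hasDerivAt_pow 2 x).div_const 2).neg
      exact this.congr_deriv (by push_cast; ring)
    exact h1.exp.neg.congr_deriv (by ring)
  have hpos : ∀ x ∈ Set.Ioi a, 0 ≤ x * Real.exp (-(x ^ 2 / 2)) := fun x hx =>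
    mul_nonneg (ha.trans (le_of_lt hx)) (Real.exp_pos _).le
  have hlim : Filter.Tendsto (fun r : ℝ => -Real.exp (-(r ^ 2 / 2))) Filter.atTop (nhds 0) := by
    rw [← neg_zero]
    refine (Real.tendsto_exp_neg_atTop_nhds_zero.comp ?_).neg
    exact (Filter.tendsto_pow_atTop two_ne_zero).atTop_div_const two_pos
  have hi := integral_Ioi_of_hasDerivAt_of_nonneg' hd hpos hlim
  have hI := integrableOn_Ioi_deriv_of_nonneg' hd hpos hlim
  have hae : (Set.Ioi a : Set ℝ) =ᵐ[volume] (Set.Ici a ∩ Set.Ioi 0 : Set ℝ) := by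
    rcases ha.eq_or_lt with rfl | ha
    · rw [Set.inter_eq_right.2 Set.Ioi_subset_Ici_self]
      exact Filter.EventuallyEq.rfl
    · have hsub : Set.Ici a ⊆ Set.Ioi 0 := fun x hx => ha.trans_le hx
      rw [Set.inter_eq_left.2 hsub]
      exact Ioi_ae_eq_Ici
  rw [rayleigh, withDensity_apply _ measurableSet_Ici, Measure.restrict_restrict measurableSet_Ici,
    ← Measure.restrict_congr_set hae,
    ← ofReal_integral_eq_lintegral_ofReal hI ((ae_restrict_iff' measurableSet_Ioi).2
      (Filter.Eventually.of_forall hpos)), hi]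
  simp

theorem rayleigh_univ : rayleigh Set.univ = 1 := by
  have h : (Set.univ : Set ℝ) =ᵐ[rayleigh] Set.Ici 0 := by
    filter_upwards [rayleigh_ae_pos] with r hr
    exact propext ⟨fun _ => hr.le, fun _ => Set.mem_univ r⟩
  rw [measure_congr h, rayleigh_Ici le_rfl]
  simp

instance : IsProbabilityMeasure rayleigh := ⟨rayleigh_univ⟩

theorem lintegral_pow_rayleigh_lt_top (k : ℕ) :
    ∫⁻ r, ENNReal.ofReal (r ^ k) ∂rayleigh < ∞ := by
  have h := integrableOn_rpow_mul_exp_neg_mul_sq (b := 1 / 2) (s := k + 1) (by norm_num)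
    (by linarith [k.cast_nonneg (α := ℝ)])
  have h' := h.lintegral_lt_top
  rw [rayleigh, lintegral_withDensity_eq_lintegral_mul _ measurable_rayleigh_density (by fun_prop)]
  refine lt_of_eq_of_lt (setLIntegral_congr_fun measurableSet_Ioi fun r hr => ?_) h'
  have hr : (0 : ℝ) < r := hr
  simp only [Pi.mul_apply]
  rw [← ENNReal.ofReal_mul (by positivity)]
  congr 1
  rw [Real.rpow_add hr, Real.rpow_natCast, Real.rpow_one,
    show -(1 / 2) * r ^ 2 = -(r ^ 2 / 2) by ring]
  ring

/-- If `b ≤ r * t` for all `r ∈ R` and `t ∈ T`, positive, then the Rayleigh measures of `R`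
and `T` have product at most `exp (-b)`. -/
theorem rayleigh_mul_rayleigh_le {R T : Set ℝ} {b : ℝ}
    (h : ∀ r ∈ R, ∀ t ∈ T, 0 < r → 0 < t → b ≤ r * t) :
    rayleigh R * rayleigh T ≤ ENNReal.ofReal (Real.exp (-b)) := by
  rcases le_or_gt b 0 with hb | hb
  · calc rayleigh R * rayleigh T ≤ 1 * 1 := mul_le_mul' prob_le_one prob_le_one
      _ ≤ _ := by
        rw [one_mul, ENNReal.one_le_ofReal]
        exact Real.one_le_exp (by linarith)
  have hinter : ∀ S : Set ℝ, rayleigh S = rayleigh (S ∩ Set.Ioi 0) := fun S => by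
    refine measure_congr ?_
    filter_upwards [rayleigh_ae_pos] with r hr
    exact propext ⟨fun hS => ⟨hS, hr⟩, fun hS => hS.1⟩
  rw [hinter R, hinter T]
  rcases (R ∩ Set.Ioi 0).eq_empty_or_nonempty with hR | hR
  · simp [hR]
  rcases (T ∩ Set.Ioi 0).eq_empty_or_nonempty with hT | ⟨t₀, ht₀, ht₀'⟩
  · simp [hT]
  -- Then `T` lies beyond `b / r₀`, and the two tails multiply to `exp (-(r₀² + (b / r₀)²) / 2) ≤
  -- exp (-b)`.
  set r₀ := sInf (R ∩ Set.Ioi 0)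
  have hbdd : BddBelow (R ∩ Set.Ioi 0) := ⟨0, fun r hr => le_of_lt hr.2⟩
  have h1 : ∀ t ∈ T ∩ Set.Ioi 0, b / t ≤ r₀ := fun t ht =>
    le_csInf hR fun r hr => (div_le_iff₀ ht.2).2 (h r hr.1 t ht.1 hr.2 ht.2)
  have hr₀ : 0 < r₀ := (div_pos hb ht₀').trans_le (h1 t₀ ⟨ht₀, ht₀'⟩)
  have hRs : R ∩ Set.Ioi 0 ⊆ Set.Ici r₀ := fun r hr => csInf_le hbdd hr
  have hTs : T ∩ Set.Ioi 0 ⊆ Set.Ici (b / r₀) := fun t ht => by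
    have := h1 t ht
    rw [div_le_iff₀ ht.2] at this
    exact (div_le_iff₀' hr₀).2 this
  calc _ ≤ rayleigh (Set.Ici r₀) * rayleigh (Set.Ici (b / r₀)) :=
        mul_le_mul' (measure_mono hRs) (measure_mono hTs)
    _ ≤ _ := by
      rw [rayleigh_Ici hr₀.le, rayleigh_Ici (by positivity), ← ENNReal.ofReal_mul (by positivity),
        ← Real.exp_add]
      refine ENNReal.ofReal_le_ofReal (Real.exp_le_exp.2 ?_)
      have e : r₀ * (b / r₀) = b := mul_div_cancel₀ _ hr₀.ne'
      nlinarith [sq_nonneg (r₀ - b / r₀)]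

/-! ### Gauge Gaussians of sets -/

section Body

set_option linter.unusedSectionVars false

variable {E : Type*} [NormedAddCommGroup E] [InnerProductSpace ℝ E] [FiniteDimensional ℝ E]
  [MeasurableSpace E] [BorelSpace E]

/-- The function `exp (-‖x‖_K² / 2)` with `‖·‖_K` the gauge of a star-shaped set `K`, written as a
mixture of indicators of dilates of `K`. -/
noncomputable def gaugeGaussian (K : Set E) (x : E) : ℝ≥0∞ := rayleigh {r | r⁻¹ • x ∈ K}

theorem measurableSet_dilates {K : Set E} (hK : MeasurableSet K) :
    MeasurableSet {p : ℝ × E | p.1⁻¹ • p.2 ∈ K} := by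
  have : Measurable fun p : ℝ × E => p.1⁻¹ • p.2 := by fun_prop
  exact this hK

theorem measurable_gaugeGaussian {K : Set E} (hK : MeasurableSet K) :
    Measurable (gaugeGaussian K) :=
  measurable_measure_prodMk_right (measurableSet_dilates hK)

/-- In polar coordinates, the measure with density `gaugeGaussian K` is the image of a product
measure. -/
theorem withDensity_gaugeGaussian {K : Set E} (hK : MeasurableSet K) :
    volume.withDensity (gaugeGaussian K) =
      ((rayleigh.withDensity fun r => ENNReal.ofReal (r ^ Module.finrank ℝ E)).prod
        (volume.restrict K)).map fun p => p.1 • p.2 := by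
  have hsm : Measurable fun p : ℝ × E => p.1 • p.2 := by fun_prop
  ext s hs
  have hms : MeasurableSet {p : ℝ × E | p.1⁻¹ • p.2 ∈ K ∧ p.2 ∈ s} :=
    (measurableSet_dilates hK).inter (measurable_snd hs)
  rw [withDensity_apply _ hs, Measure.map_apply hsm hs, Measure.prod_apply (hsm hs),
    lintegral_withDensity_eq_lintegral_mul _ (by fun_prop)
      (measurable_measure_prodMk_left (hsm hs)), ← lintegral_indicator hs]
  calc _ = ∫⁻ x, rayleigh ((fun r => (r, x)) ⁻¹' {p : ℝ × E | p.1⁻¹ • p.2 ∈ K ∧ p.2 ∈ s}) := by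
        congr with x
        by_cases hx : x ∈ s <;> simp [hx, gaugeGaussian]
    _ = (rayleigh.prod volume) {p : ℝ × E | p.1⁻¹ • p.2 ∈ K ∧ p.2 ∈ s} :=
        (Measure.prod_apply_symm hms).symm
    _ = ∫⁻ r, volume (Prod.mk r ⁻¹' {p : ℝ × E | p.1⁻¹ • p.2 ∈ K ∧ p.2 ∈ s}) ∂rayleigh :=
        Measure.prod_apply hms
    _ = _ := by
        refine lintegral_congr_ae ?_
        filter_upwards [rayleigh_ae_pos] with r hr
        -- Rescaling the slice by `r` produces the Jacobian `r ^ n`.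
        have : Prod.mk r ⁻¹' {p : ℝ × E | p.1⁻¹ • p.2 ∈ K ∧ p.2 ∈ s} =
            r • (Prod.mk r ⁻¹' ((fun p : ℝ × E => p.1 • p.2) ⁻¹' s) ∩ K) := by
          ext x
          rw [Set.mem_smul_set_iff_inv_smul_mem₀ hr.ne']
          simp [hr.ne', and_comm]
        rw [this, Measure.addHaar_smul, abs_of_pos (by positivity), Pi.mul_apply,
          Measure.restrict_apply (measurable_prodMk_left (hsm hs))]

/-- The factor depends only on the dimension, so it is the same for `K`, its polar and the ball. -/
theorem lintegral_gaugeGaussian {K : Set E} (hK : MeasurableSet K) :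
    ∫⁻ x, gaugeGaussian K x =
      (∫⁻ r, ENNReal.ofReal (r ^ Module.finrank ℝ E) ∂rayleigh) * volume K := by
  have h := congrArg (fun m => m Set.univ) (withDensity_gaugeGaussian hK)
  simp only [withDensity_apply _ MeasurableSet.univ, Measure.restrict_univ] at h
  rw [h, Measure.map_apply (by fun_prop) MeasurableSet.univ, Set.preimage_univ, ← Set.univ_prod_univ,
    Measure.prod_prod]
  simp

theorem integrable_id_rayleigh_withDensity (n : ℕ) :
    Integrable (fun r : ℝ => r) (rayleigh.withDensity fun r => ENNReal.ofReal (r ^ n)) := by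
  refine ⟨by fun_prop, ?_⟩
  rw [HasFiniteIntegral, lintegral_withDensity_eq_lintegral_mul _ (by fun_prop) (by fun_prop)]
  refine lt_of_eq_of_lt (lintegral_congr_ae ?_) (lintegral_pow_rayleigh_lt_top (n + 1))
  filter_upwards [rayleigh_ae_pos] with r hr
  rw [Pi.mul_apply, Real.enorm_eq_ofReal hr.le, ← ENNReal.ofReal_mul (by positivity), pow_succ]

theorem isFiniteMeasure_rayleigh_withDensity (n : ℕ) :
    IsFiniteMeasure (rayleigh.withDensity fun r => ENNReal.ofReal (r ^ n)) :=
  isFiniteMeasure_withDensity (lintegral_pow_rayleigh_lt_top n).ne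

theorem integrable_id_gaugeGaussian {K : Set E} (hK : IsCompact K) :
    Integrable (fun x => x) (volume.withDensity (gaugeGaussian K)) := by
  have := isFiniteMeasure_rayleigh_withDensity (Module.finrank ℝ E)
  rw [withDensity_gaugeGaussian hK.measurableSet,
    integrable_map_measure (by fun_prop) (by fun_prop)]
  exact (integrable_id_rayleigh_withDensity _).smul_prod
    (continuous_id.continuousOn.integrableOn_compact hK)

/-- In polar coordinates the first moment is a radial moment times `∫ x in K, x`. -/
theorem integral_id_gaugeGaussian {K : Set E} (hK : IsCompact K) (h0 : ∫ x in K, x = 0) :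
    ∫ x, x ∂(volume.withDensity (gaugeGaussian K)) = 0 := by
  have := isFiniteMeasure_rayleigh_withDensity (Module.finrank ℝ E)
  rw [withDensity_gaugeGaussian hK.measurableSet, integral_map (by fun_prop) (by fun_prop)]
  rw [integral_prod_smul (fun r : ℝ => r) (fun x : E => x), h0, smul_zero]

theorem gaugeGaussian_closedBall (x : E) :
    gaugeGaussian (Metric.closedBall 0 1) x = ENNReal.ofReal (Real.exp (-(1 / 2) * ‖x‖ ^ 2)) := by
  have : {r : ℝ | r⁻¹ • x ∈ Metric.closedBall (0 : E) 1} =ᵐ[rayleigh] Set.Ici ‖x‖ := by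
    filter_upwards [rayleigh_ae_pos] with r hr
    refine propext ?_
    change r⁻¹ • x ∈ Metric.closedBall (0 : E) 1 ↔ ‖x‖ ≤ r
    rw [mem_closedBall_zero_iff, norm_smul, norm_inv, Real.norm_of_nonneg hr.le,
      inv_mul_le_iff₀ hr, mul_one]
  rw [gaugeGaussian, measure_congr this, rayleigh_Ici (norm_nonneg _)]
  congr 2; ring

/-- The ball yields the standard Gaussian, which attains the functional constant. -/
theorem lintegral_gaugeGaussian_closedBall_sq :
    (∫⁻ x : E, gaugeGaussian (Metric.closedBall 0 1) x) ^ 2 =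
      ENNReal.ofReal (2 * Real.pi) ^ Module.finrank ℝ E := by
  have h := GaussianFourier.integral_rexp_neg_mul_sq_norm (V := E) (b := 1 / 2) (by norm_num)
  have hpos : 0 < Real.pi / (1 / 2) := by positivity
  have hI : Integrable fun v : E => Real.exp (-(1 / 2) * ‖v‖ ^ 2) :=
    Integrable.of_integral_ne_zero (by rw [h]; positivity)
  simp_rw [gaugeGaussian_closedBall]
  rw [← ofReal_integral_eq_lintegral_ofReal hI
    (Filter.Eventually.of_forall fun _ => (Real.exp_pos _).le), h, ← ENNReal.ofReal_pow
    (by positivity), ← ENNReal.ofReal_pow (by positivity)]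
  congr 1
  rw [← Real.rpow_mul_natCast hpos.le]
  push_cast
  rw [div_mul_cancel₀ _ (two_ne_zero), Real.rpow_natCast]
  congr 1
  ring

end Body

/-! ### Polar bodies and the volume inequality -/

theorem measurableSet_polarBody {n : ℕ} (K : Set (EuclideanSpace ℝ (Fin n))) :
    MeasurableSet (polarBody K) := by
  have : polarBody K = ⋂ x ∈ K, {y | inner ℝ x y ≤ 1} := by
    ext y; simp [polarBody]
  rw [this]
  exact (isClosed_biInter fun x _ => isClosed_le (by fun_prop) continuous_const).measurableSet

/-- If `r⁻¹ • x ∈ K` and `t⁻¹ • y` is in the polar, with `r, t > 0`, then `⟨x, y⟩ ≤ r * t`. -/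
theorem gaugeGaussian_mul_polarBody_le {n : ℕ} (K : Set (EuclideanSpace ℝ (Fin n)))
    (x y : EuclideanSpace ℝ (Fin n)) :
    gaugeGaussian K x * gaugeGaussian (polarBody K) y ≤
      ENNReal.ofReal (Real.exp (-inner ℝ x y)) := by
  refine rayleigh_mul_rayleigh_le fun r hr t ht hr0 ht0 => ?_
  have h : inner ℝ (r⁻¹ • x) (t⁻¹ • y) ≤ 1 := ht _ hr
  rw [real_inner_smul_left, real_inner_smul_right, inv_mul_le_iff₀ hr0, inv_mul_le_iff₀ ht0] at h
  linarith

/-- The Blaschke–Santaló inequality for compact sets with barycenter at the origin. -/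
theorem IsCompact.volume_mul_volume_polarBody_le {n : ℕ} {K : Set (EuclideanSpace ℝ (Fin n))}
    (hK : IsCompact K) (h0 : ∫ x in K, x = 0) :
    volume K * volume (polarBody K) ≤
      volume (Metric.closedBall (0 : EuclideanSpace ℝ (Fin n)) 1) ^ 2 := by
  set c := ∫⁻ r, ENNReal.ofReal (r ^ Module.finrank ℝ (EuclideanSpace ℝ (Fin n))) ∂rayleigh with hc
  have hct : c ≠ ∞ := (lintegral_pow_rayleigh_lt_top _).ne
  have key := functionalSantalo_euclideanSpace n (gaugeGaussian K) (gaugeGaussian (polarBody K))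
    (measurable_gaugeGaussian hK.measurableSet)
    (measurable_gaugeGaussian (measurableSet_polarBody K))
    (by
      rw [lintegral_gaugeGaussian hK.measurableSet]
      exact ENNReal.mul_ne_top hct hK.measure_ne_top)
    (integrable_id_gaugeGaussian hK) (integral_id_gaugeGaussian hK h0)
    (gaugeGaussian_mul_polarBody_le K)
  have hball := lintegral_gaugeGaussian_closedBall_sq (E := EuclideanSpace ℝ (Fin n))
  rw [lintegral_gaugeGaussian Metric.isClosed_closedBall.measurableSet, ← hc,
    finrank_euclideanSpace_fin] at hball
  have hc0 : c ≠ 0 := by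
    rintro h
    rw [h, zero_mul, zero_pow two_ne_zero] at hball
    have : ENNReal.ofReal (2 * Real.pi) ^ n ≠ 0 :=
      pow_ne_zero _ (by simpa using Real.pi_pos)
    exact this hball.symm
  rw [lintegral_gaugeGaussian hK.measurableSet,
    lintegral_gaugeGaussian (measurableSet_polarBody K), ← hc, ← hball, mul_pow,
    mul_mul_mul_comm, ← sq] at key
  exact (ENNReal.mul_le_mul_iff_right (pow_ne_zero 2 hc0) (ENNReal.pow_ne_top hct)).1 key

theorem mainTheorem11 (n : ℕ) (K : Set (EuclideanSpace ℝ (Fin n)))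
    (hK : IsStarShapedBody K) (hbar : barycenter K = 0) :
    volume K * volume (polarBody K) ≤
      volume (Metric.closedBall (0 : EuclideanSpace ℝ (Fin n)) 1) ^ 2 := by
  refine hK.isCompact.volume_mul_volume_polarBody_le ?_
  -- Positive volume allows the normalizing factor of the barycenter to be dropped.
  have hpos : 0 < volume.real K :=
    ENNReal.toReal_pos (Measure.measure_pos_of_nonempty_interior _ hK.interior_nonempty).ne'
      hK.isCompact.measure_ne_top
  exact (smul_eq_zero.1 hbar).resolve_left (inv_ne_zero hpos.ne')
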